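/- An oriented graph is a directed graph without loops, multiple arcs or 2-cycles. For oriented graphs $H$ (on $k$ vertices) and $G$, let $N(H,G)$ be the number of $k$-subsets of $V(G)$ that induce a subgraph of $G$ isomorphic to $H$, and let the inducibility of $H$ be $$I(H)=\lim_{n\to\infty}\frac{\max\{N(H,G): G \text{ an oriented graph},\ |V(G)|=n\}}{\binom nk}.$$ Let $H$ be the orientation of the star $K_{1,3}$ in which the centre has two out-neighbours and one in-neighbour, and let $\overleftarrow H$ be obtained from $H$ by reversing all arcs. Then the limits exist and $$I(H)=I(\overleftarrow H)=\frac{81}{400}.$$ Moreover, this value is attained asymptotically by the following construction. For each $n$, split an $n$-element vertex set into five parts $A,B,C,D,E$ whose sizes divided by $n$ tend, as $n\to\infty$, to $\frac3{20},\frac14,\frac3{20},\frac14,\frac15$ respectively (such partitions exist), and let $G_n$ be the oriented graph whose arcs are all the arcs from $A$ to $B$, from $B$ to $C$, from $C$ to $D$, from $D$ to $A$, from $C$ to $E$ and from $A$ to $E$. For every such sequence, $N(H,G_n)/\binom n4\to\frac{81}{400}$ and, for the graphs $\overleftarrow{G_n}$ obtained by reversing all arcs, $N(\overleftarrow H,\overleftarrow{G_n})/\binom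 n4\to\frac{81}{400}$. -/

import Mathlib

open Filter Topology

/-- An oriented graph: a digraph without loops, multiple arcs or 2-cycles. (Asymmetry of the
adjacency relation also excludes loops.) -/
structure OrientedGraph (V : Type*) extends Digraph V where
  asymm : ∀ u v : V, Adj u v → ¬ Adj v u

namespace OrientedGraph

/-- The oriented graph obtained by reversing all arcs. -/
def reverse {V : Type*} (G : OrientedGraph V) : OrientedGraph V where
  Adj u v := G.Adj v u
  asymm u v h := G.asymm v u h

/-- The subgraph of `G` induced by a finite set of vertices. -/
def induce {V : Type*} (G : OrientedGraph V) (S : Finset V) : OrientedGraph S where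
  Adj u v := G.Adj u v
  asymm u v h := G.asymm u v h

/-- Isomorphism of oriented graphs: a bijection of the vertices preserving and reflecting arcs. -/
def Isomorphic {V W : Type*} (G : OrientedGraph V) (H : OrientedGraph W) : Prop :=
  Nonempty (G.Adj ≃r H.Adj)

open Classical in
/-- `N(H, G)`: the number of `|V(H)|`-sets of vertices of `G` inducing a graph isomorphic
to `H`. -/
noncomputable def inducedCopies {W V : Type*} [Fintype W] [Fintype V]
    (H : OrientedGraph W) (G : OrientedGraph V) : ℕ :=
  (((Finset.univ : Finset V).powersetCard (Fintype.card W)).filter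
    (fun S => (G.induce S).Isomorphic H)).card

/-- The maximum of `N(H, G)` over all oriented graphs `G` on `n` vertices. -/
noncomputable def maxInducedCopies {W : Type*} [Fintype W] (H : OrientedGraph W) (n : ℕ) : ℕ :=
  sSup (Set.range fun G : OrientedGraph (Fin n) => inducedCopies H G)

/-- The supremum in `maxInducedCopies` is an attained maximum. -/
theorem isGreatest_maxInducedCopies {W : Type*} [Fintype W] (H : OrientedGraph W) (n : ℕ) :
    IsGreatest (Set.range fun G : OrientedGraph (Fin n) => inducedCopies H G)
      (maxInducedCopies H n) := by
  have hne : (Set.range fun G : OrientedGraph (Fin n) => inducedCopies H G).Nonempty :=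
    ⟨_, ⟨⟨fun _ _ => False⟩, fun _ _ h => h.elim⟩, rfl⟩
  have hb : BddAbove (Set.range fun G : OrientedGraph (Fin n) => inducedCopies H G) := by
    refine ⟨((Finset.univ : Finset (Fin n)).powersetCard (Fintype.card W)).card, ?_⟩
    rintro _ ⟨G, rfl⟩
    classical exact Finset.card_filter_le _ _
  exact ⟨Nat.sSup_mem hne hb, fun _ h => le_csSup hb h⟩

/-- `H` has inducibility `c`: the limit of `max {N(H, G) : |V(G)| = n} / (n choose |V(H)|)` as
`n → ∞` exists and equals `c`. -/
def HasInducibility {W : Type*} [Fintype W] (H : OrientedGraph W) (c : ℝ) : Prop :=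
  Tendsto (fun n : ℕ => (maxInducedCopies H n : ℝ) / (n.choose (Fintype.card W) : ℝ)) atTop (𝓝 c)

/-- The induced density of `H` in a finite oriented graph `G`. -/
noncomputable def inducedDensity {W V : Type*} [Fintype W] [Fintype V]
    (H : OrientedGraph W) (G : OrientedGraph V) : ℝ :=
  (inducedCopies H G : ℝ) / ((Fintype.card V).choose (Fintype.card W) : ℝ)

/-- The blow-up of `P` along an assignment `f` of vertices to parts: the parts are independent
sets, and all arcs from part `i` to part `j` are present exactly when `P` has the arc `i → j`. -/
def blowup {I V : Type*} (P : OrientedGraph I) (f : V → I) : OrientedGraph V where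
  Adj u v := P.Adj (f u) (f v)
  asymm u v h := P.asymm (f u) (f v) h

/-- Partitions `f n` of an `n`-vertex set whose `i`-th part has size `(α i + o(1)) n`. -/
def HasLimitPartSizes {I : Type*} [DecidableEq I] (f : (n : ℕ) → Fin n → I) (α : I → ℝ) : Prop :=
  ∀ i, Tendsto (fun n : ℕ => ((Finset.univ.filter fun v : Fin n => f n v = i).card : ℝ) / (n : ℝ))
    atTop (𝓝 (α i))

/-- The orientation of the star `K_{1,3}` with centre `0` and arcs `0 → 1`, `0 → 2`, `3 → 0`. -/
def mixedStar : OrientedGraph (Fin 4) where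
  Adj u v := (u, v) ∈ ({(0, 1), (0, 2), (3, 0)} : Finset (Fin 4 × Fin 4))
  asymm := by decide

/-- The pattern of the extremal construction on parts `A, B, C, D, E` (numbered `0, 1, 2, 3, 4`):
`A → B`, `B → C`, `C → D`, `D → A`, `C → E`, `A → E`. -/
def fivePattern : OrientedGraph (Fin 5) where
  Adj i j := (i, j) ∈
    ({(0, 1), (1, 2), (2, 3), (3, 0), (2, 4), (0, 4)} : Finset (Fin 5 × Fin 5))
  asymm := by decide

/-- The sizes of the parts `A, B, C, D, E` of the extremal construction. -/
noncomputable def fivePartSizes : Fin 5 → ℝ := ![3 / 20, 1 / 4, 3 / 20, 1 / 4, 1 / 5]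

end OrientedGraph

/-!
Write `n` for the number of vertices of an oriented graph `G`, and call a map `φ` from the four
vertices of the star to `V(G)` an induced map if it preserves and reflects arcs; it need not be
injective, since the two out-leaves may coincide. The star has exactly two automorphisms, so
`2 N(H, G)` is the number of injective induced maps (`card_inducedEmbeddings`), which differs from
the number `T` of all induced maps by `O(n³)`.

*Upper bound.* The inequality `4800 T ≤ 81 n⁴` (`starCount_le`) has a flag algebra proof in the form
of a sum of squares over five vertices. For each isomorphism type of labelled triple `(a, b, c)` in
a short list, and for single roots `a`, there are integer vectors `g` indexed by the ways in which a
further vertex `d` (respectively an unordered pair `{b, c}` of further vertices) attaches to the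
root. A sum `∑ w (∑ g)²` over all placements of the root is nonnegative; expanded, it is a sum over
`5`-tuples of vertices. Adding `2400000` times the number of stars on `(a, b, c, d)` and on
`(a, b, c, e)`, one gets a function of `5`-tuples whose sum over the orderings of any five vertices
is at most a constant (`total_le`); summing this over all of `V⁵` gives the bound. Tuples with
repeated vertices are treated as tuples of pairwise nonadjacent copies, so that the inequality holds
for every finite `G` without an error term. The vectors and weights were found by semidefinite
programming and rounded; that they satisfy the inequality is a finite check on the arc patterns of
five vertices (`certificate_eq_true`). The check is made feasible by looking only at patterns whose
listing of the vertices is locally minimal for a suitable weight (`minimalFor`), which is harmless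
because the sum over all orderings does not depend on the listing (`total_comp_perm`).

*Lower bound.* The number of induced maps into a blow-up is the sum over induced maps `g` into the
pattern of `∏ᵢ |part g(i)|` (`card_inducedMaps_blowup`), so its limiting density is a polynomial in
the limiting part sizes. For the five-part construction this polynomial takes the value `81 / 4800`,
which matches the upper bound. Reversing all arcs changes neither counts nor maxima.
-/

namespace OrientedGraph

/-! ### The sum-of-squares certificate -/

/-- Weighted squares for the type with the single arc `a → b` and isolated `c`. In this and the
following lists a member `(w, g)` stands for `w` times the square of the linear form with
coefficients `g`, whose `27` coordinates are indexed by `flagIndex`. -/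
def arcSquares : List (ℕ × List ℤ) :=
  [(1, [194, -225, -225, 536, 28, -7, 1456, 37, -109, 375, -109, 37, 549, -364, -1038, 630, 74,
     0, 786, -7, 28, 1120, 126, 0, 630, 0, 1750]),
    (1, [231, -77, -77, 144, 6, -2, 94, 8, -24, 739, -24, 8, -558, -28, -286, -523, 20, 0, -310,
     -2, 6, -311, 35, 0, -523, 0, 381]),
    (1, [-41, 52, 52, 7, -3, 1, -26, -4, 11, 399, 11, -4, 162, -19, 3, 159, 0, 0, -292, 1, -3,
     139, 0, 0, 159, 0, -172])]

/-- Weighted squares for the type with arcs `b → a → c` and `b, c` nonadjacent. -/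
def pathSquares : List (ℕ × List ℤ) :=
  [(1, [-656, 0, 0, 0, -98, -98, 0, 720, 720, 666, 0, 0, 0, 428, 179, 0, 16, 214, -1572, -74,
     -49, -1165, -888, -43, -1291, -257, -111]),
    (1, [464, 0, 0, 0, 354, 354, 0, -531, -531, 354, 0, 0, 0, -663, -762, 0, 120, -243, -531, -24,
     -43, -422, -56, -855, -464, 64, -271]),
    (172, [0, 0, 0, 0, 1, 1, 0, 0, 0, 3, 0, 0, 0, 0, 0, 0, 0, 0, -6, 0, 0, 0, 0, 0, 0, 0, 0]),
    (47, [0, 0, 0, 0, 2, 2, 0, -3, -3, 2, 0, 0, 0, 0, 0, 0, 0, 0, -3, 0, 0, 0, 0, 0, 0, 0, 0])]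

/-- Weighted squares for the type with arcs `b → a` and `c → a` and `b, c` nonadjacent. -/
def inCherrySquares : List (ℕ × List ℤ) :=
  [(1, [0, 545, 342, -545, 0, -2007, -342, 2007, 0, 0, 349, 277, -349, 0, -302, -277, 302, 0, 0,
     407, 335, -407, 0, 0, -335, 0, 0]),
    (1, [447, 26, -7, 26, 546, -294, -7, -294, -1134, 126, 113, 123, 113, -216, -100, 123, -100,
     100, 126, 18, 37, 18, -11, -146, 37, -146, -603]),
    (1, [0, 661, 416, -661, 0, 0, -416, 0, 0, 0, 0, 0, 0, 0, 0, 0, 0, 0, 0, -2, -1, 2, 0, 0, 1, 0,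
     0]),
    (1, [0, 1, 0, -1, 0, 0, 0, 0, 0, 0, 0, 0, 0, 0, 0, 0, 0, 0, 0, 240, 198, -240, 0, 0, -198, 0,
     0]),
    (239, [0, 0, 0, 0, 0, -1, 0, 1, 0, 0, 0, 0, 0, 0, 0, 0, 0, 0, 0, 0, 0, 0, 0, 0, 0, 0, 0]),
    (184, [0, 0, 0, 0, 13, -7, 0, -7, -27, 3, 0, 0, 0, 0, 0, 0, 0, 0, 3, 0, 0, 0, 0, 0, 0, 0, 0])]

/-- Weighted squares for the transitive triangle `a → b`, `a → c`, `b → c`. -/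
def triangleSquares : List (ℕ × List ℤ) :=
  [(1, [-49, -74, 4, 0, 39, 386, 120, -504, 38, -149, 485, 40, 102, 111, 64, -2369, -319, -95, 0,
     -613, -749, 2525, 364, 703, -224, -399, -117]),
    (1, [140, 262, -44, 0, -80, -499, 139, 583, 226, 11, 560, 789, -692, -397, -281, -185, 878,
     127, 0, -710, -1040, 107, -484, -786, 1397, 576, 321]),
    (1, [62, 12, -30, 0, -74, 269, -68, 325, 199, 292, -173, -312, 218, -141, -161, -208, 315,
     -102, 0, 310, 56, 246, -144, -658, -445, 365, 164])]

/-- Weighted squares for a single root `a`, whose coordinates are indexed by the way two further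
vertices `b, c` sit with respect to `a` and each other. The vectors are invariant under exchanging
`b` and `c`. -/
def vertexSquares : List (ℕ × List ℤ) :=
  [(1, [105, -433, -433, 394, -70, -380, 338, -460, 234, 394, -380, -70, -175, -204, -204, 519,
     -192, 10, 338, 234, -460, 519, 10, -192, -507, -100, -100]),
    (1, [0, -148, -148, 9, 0, 1, 191, -9, -158, 9, 1, 0, -805, 104, 104, 644, -47, 43, 191, -158,
     -9, 644, 43, -47, 489, -40, -40]),
    (1, [-15, 389, 389, 173, 400, -162, 0, -32, 99, 173, -162, 400, -210, -67, -67, -75, -119,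
     570, 0, 99, -32, -75, 570, -119, -162, -162, -162]),
    (1, [261, 147, 147, 342, -174, -529, 252, 150, -456, 342, -529, -174, 261, -268, -268, 174,
     -258, 21, 252, -456, 150, 174, 21, -258, -303, -313, -313]),
    (102, [0, 0, 0, 0, -3, 0, 0, 0, 1, 0, 0, -3, -1, 0, 0, 4, 0, 0, 0, 1, 0, 4, 0, 0, -3, 0, 0]),
    (56, [0, 0, 0, 0, -3, 0, 0, 0, 0, 0, 0, -3, -6, 0, 0, 8, 0, 0, 0, 0, 0, 8, 0, 0, 0, 0, 0]),
    (144, [0, 0, 0, 0, 0, 0, 0, 0, -1, 0, 0, 0, -5, 0, 0, 4, 0, 0, 0, -1, 0, 4, 0, 0, 3, 0, 0]),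
    (36, [0, 0, 0, 0, 9, -3, 0, 0, 0, 0, -3, 9, -2, 0, 0, -5, 0, 0, 0, 0, 0, -5, 0, 0, 0, 0, 0]),
    (40, [0, 0, 0, 0, 6, -3, 0, 0, 2, 0, -3, 6, 2, 0, 0, -5, 0, 0, 0, 2, 0, -5, 0, 0, -6, 0, 0]),
    (50, [0, 0, 0, 0, 6, -3, 0, 0, 1, 0, -3, 6, -3, 0, 0, -1, 0, 0, 0, 1, 0, -1, 0, 0, -3, 0, 0]),
    (5, [3, 0, 0, 0, 1, -6, 0, 1, -6, 0, -6, 1, 4, 0, 0, -2, 0, 0, 0, -6, 1, -2, 0, 0, 0, 0, 0]),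
    (15, [3, 0, 0, 0, -2, -6, 0, 1, -6, 0, -6, -2, -2, 0, 0, 6, 0, 0, 0, -6, 1, 6, 0, 0, 0, 0, 0]),
    (35, [3, 0, 0, 0, -8, -3, 0, 1, -6, 0, -3, -8, 6, 0, 0, 3, 0, 0, 0, -6, 1, 3, 0, 0, 0, 0, 0]),
    (106, [3, 0, 0, 0, -2, -6, 0, 1, -5, 0, -6, -2, 3, 0, 0, 2, 0, 0, 0, -5, 1, 2, 0, 0, -3, 0,
     0]),
    (4, [0, 0, 0, 0, -3, -1, 0, 9, -2, 0, -1, -3, -1, 0, 0, 4, 0, 0, 0, -2, 9, 4, 0, 0, -9, 0, 0]),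
    (39, [0, 0, 0, 0, 0, -1, 0, 9, -2, 0, -1, 0, 5, 0, 0, -4, 0, 0, 0, -2, 9, -4, 0, 0, -9, 0, 0]),
    (12, [0, 0, 0, 0, -6, 2, 0, 9, -4, 0, 2, -6, 3, 0, 0, 1, 0, 0, 0, -4, 9, 1, 0, 0, -3, 0, 0]),
    (20, [3, 0, 0, 0, -2, -7, 0, 10, -8, 0, -7, -2, 3, 0, 0, 2, 0, 0, 0, -8, 10, 2, 0, 0, -9, 0,
     0]),
    (131, [0, 0, 0, 0, 0, -1, 0, 9, -3, 0, -1, 0, 0, 0, 0, 0, 0, 0, 0, -3, 9, 0, 0, 0, -6, 0, 0])]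
/-- The entry `(i, j)` of the positive semidefinite matrix `∑ w g gᵀ` belonging to a list of
weighted squares. -/
def gram (S : List (ℕ × List ℤ)) (i j : ℕ) : ℤ :=
  (S.map fun s => (s.1 : ℤ) * (s.2.getD i 0 * s.2.getD j 0)).sum

/-- The matrix `gram S` as a table, so that the kernel computes it only once. -/
def gramTable (S : List (ℕ × List ℤ)) : List (List ℤ) :=
  (List.range 27).map fun i => (List.range 27).map (gram S i)

/-- The entry of `gramTable S` at `(i, j)`; it equals `gram S i j` for `i, j < 27`. -/
def entry (S : List (ℕ × List ℤ)) (i j : ℕ) : ℤ := ((gramTable S).getD i []).getD j 0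

/-- The index of a flag, the number with base-`3` digits `x, y, z`. Each digit describes an ordered
pair `(u, v)` of vertices: `1` if `u → v`, `2` if `v → u`, and `0` otherwise. -/
def flagIndex (x y z : ℕ) : ℕ := 9 * x + 3 * y + z

/-- The product term of two flags `{b, c}` and `{d, e}` over the root `a`, for a graph given by the
digits `r u v`. -/
def rootedPair (S : List (ℕ × List ℤ)) {ι : Type*} (r : ι → ι → ℕ) (a b c d e : ι) : ℤ :=
  entry S (flagIndex (r a b) (r a c) (r b c)) (flagIndex (r a d) (r a e) (r d e))

/-- The contribution of a labelled triple of type `(x, y, z) = (r a b, r a c, r b c)` with two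
further vertices attached by the flags `i` and `j`: a product term for the four types carrying
squares, and for the out-cherry `a → b`, `a → c` the (scaled) number of stars, as the flag `18`
describes a vertex `d` whose only arc to the triple is `d → a`. -/
def typeTerm (x y z i j : ℕ) : ℤ :=
  match x, y, z with
  | 1, 0, 0 => entry arcSquares i j
  | 2, 1, 0 => entry pathSquares i j
  | 2, 2, 0 => entry inCherrySquares i j
  | 1, 1, 1 => entry triangleSquares i j
  | 1, 1, 0 => (bif i == 18 then 2400000 else 0) + (bif j == 18 then 2400000 else 0)
  | _, _, _ => 0

/-- `typeTerm` for the labelled triple `(a, b, c)` and the further vertices `d` and `e`. -/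
def tripleTerm {ι : Type*} (r : ι → ι → ℕ) (a b c d e : ι) : ℤ :=
  typeTerm (r a b) (r a c) (r b c)
    (flagIndex (r a d) (r b d) (r c d)) (flagIndex (r a e) (r b e) (r c e))

/-- The `15` ways to choose a root among five vertices and to split the rest into two pairs. -/
def pairings : List (Fin 5 × Fin 5 × Fin 5 × Fin 5 × Fin 5) :=
  [(0, 1, 2, 3, 4), (0, 1, 3, 2, 4), (0, 1, 4, 2, 3), (1, 0, 2, 3, 4), (1, 0, 3, 2, 4),
    (1, 0, 4, 2, 3), (2, 0, 1, 3, 4), (2, 0, 3, 1, 4), (2, 0, 4, 1, 3), (3, 0, 1, 2, 4),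
    (3, 0, 2, 1, 4), (3, 0, 4, 1, 2), (4, 0, 1, 2, 3), (4, 0, 2, 1, 3), (4, 0, 3, 1, 2)]

/-- Half of the sum of `orderedTerm` over the eight orderings belonging to one pairing. -/
def pairingTerm (p : Fin 5 → Fin 5 → ℕ) (a b c d e : Fin 5) : ℤ :=
  4 * rootedPair vertexSquares p a b c d e +
    (tripleTerm p a b c d e + tripleTerm p a c b d e +
      tripleTerm p a d e b c + tripleTerm p a e d b c)

/-- The quantity bounded by the certificate. It is half of the sum of `orderedTerm` over all
orderings of the five vertices; see `sum_perm_orderedTerm`. -/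
def total (p : Fin 5 → Fin 5 → ℕ) : ℤ :=
  (pairings.map fun (a, b, c, d, e) => pairingTerm p a b c d e).sum

/-- The digit of `(v, u)`, given the digit of `(u, v)`. -/
def opp : ℕ → ℕ
  | 0 => 0
  | 1 => 2
  | _ => 1

/-- The digits between five vertices, given those of the ten pairs in the order
`01, 02, 03, 12, 13, 23, 04, 14, 24, 34`. The pairs among the first four vertices come first. -/
def pattern (a b c d e f g h i j : ℕ) : Fin 5 → Fin 5 → ℕ
  | 0, 1 => a | 0, 2 => b | 0, 3 => c | 1, 2 => d | 1, 3 => e | 2, 3 => f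
  | 0, 4 => g | 1, 4 => h | 2, 4 => i | 3, 4 => j
  | 1, 0 => opp a | 2, 0 => opp b | 3, 0 => opp c | 2, 1 => opp d | 3, 1 => opp e | 3, 2 => opp f
  | 4, 0 => opp g | 4, 1 => opp h | 4, 2 => opp i | 4, 3 => opp j
  | _, _ => 0

/-- The number with base-`3` digits those of the six pairs among `a, b, c, d`. -/
def code4 (p : Fin 5 → Fin 5 → ℕ) (a b c d : Fin 5) : ℕ :=
  243 * p a b + 81 * p a c + 27 * p a d + 9 * p b c + 3 * p b d + p c d

/-- `1` if the digit belongs to an adjacent pair, and `0` otherwise. -/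
def sgn : ℕ → ℕ
  | 0 => 0
  | _ => 1

/-- The number of arcs among `a, b, c, d`. -/
def arcs4 (p : Fin 5 → Fin 5 → ℕ) (a b c d : Fin 5) : ℕ :=
  sgn (p a b) + sgn (p a c) + sgn (p a d) + sgn (p b c) + sgn (p b d) + sgn (p c d)

/-- The weight by which a listing of five vertices is chosen, a function of the first four of them:
first the number of arcs among these is minimized, then their pattern lexicographically. -/
def orderWeight (p : Fin 5 → Fin 5 → ℕ) (t : Fin 5 × Fin 5 × Fin 5 × Fin 5) : ℕ :=
  match t with
  | (a, b, c, d) => 729 * arcs4 p a b c d + code4 p a b c d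

/-- The first four vertices after each transposition of two of them. -/
def swaps4 : List (Fin 5 × Fin 5 × Fin 5 × Fin 5) :=
  [(1, 0, 2, 3), (2, 1, 0, 3), (3, 1, 2, 0), (0, 2, 1, 3), (0, 3, 2, 1), (0, 1, 3, 2)]

/-- The first four vertices after each transposition with the fifth. -/
def swaps5 : List (Fin 5 × Fin 5 × Fin 5 × Fin 5) :=
  [(4, 1, 2, 3), (0, 4, 2, 3), (0, 1, 4, 3), (0, 1, 2, 4)]

/-- The given listing has weight at most that of every listing in `L`. -/
def minimalFor (L : List (Fin 5 × Fin 5 × Fin 5 × Fin 5)) (p : Fin 5 → Fin 5 → ℕ) : Bool :=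
  L.all fun t => Nat.ble (orderWeight p (0, 1, 2, 3)) (orderWeight p t)

/-- The possible digits. -/
def digits : List ℕ := [0, 1, 2]

/-- The finite check: `total p ≤ 4860000` for every pattern `p` whose listing is minimal for all ten
transpositions. Minimality among the first four vertices does not involve the fifth, whence the
zeros, and is tested before the arcs at the fifth vertex are chosen. -/
def certificate : Bool :=
  digits.all fun a => digits.all fun b => digits.all fun c => digits.all fun d =>
  digits.all fun e => digits.all fun f =>
    !(minimalFor swaps4 (pattern a b c d e f 0 0 0 0)) ||
    digits.all fun g => digits.all fun h => digits.all fun i => digits.all fun j =>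
      !(minimalFor swaps5 (pattern a b c d e f g h i j)) ||
        decide (total (pattern a b c d e f g h i j) ≤ 4860000)

theorem certificate_eq_true : certificate = true := by decide +kernel

/-! ### The bound for five vertices -/

/-- `r` is a system of digits coming from an oriented graph: `r u v` is `1` if `u → v`, `2` if
`v → u` and `0` otherwise. -/
structure IsArcCode {ι : Type*} (r : ι → ι → ℕ) : Prop where
  lt_three : ∀ u v, r u v < 3
  opp_eq : ∀ u v, r v u = opp (r u v)

theorem IsArcCode.self_eq_zero {ι : Type*} {r : ι → ι → ℕ} (hr : IsArcCode r) (u : ι) :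
    r u u = 0 := by
  have h1 := hr.lt_three u u
  have h2 := hr.opp_eq u u
  generalize r u u = k at h1 h2
  interval_cases k
  · rfl
  · exact absurd h2 (by decide)
  · exact absurd h2 (by decide)

theorem IsArcCode.comp {ι κ : Type*} {r : ι → ι → ℕ} (hr : IsArcCode r) (x : κ → ι) :
    IsArcCode fun i j => r (x i) (x j) :=
  ⟨fun _ _ => hr.lt_three _ _, fun _ _ => hr.opp_eq _ _⟩

theorem IsArcCode.eq_pattern {p : Fin 5 → Fin 5 → ℕ} (hp : IsArcCode p) :
    p = pattern (p 0 1) (p 0 2) (p 0 3) (p 1 2) (p 1 3) (p 2 3)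
      (p 0 4) (p 1 4) (p 2 4) (p 3 4) := by
  funext i j
  fin_cases i <;> fin_cases j <;>
    first
    | exact hp.self_eq_zero _
    | rfl
    | exact hp.opp_eq _ _

theorem total_le_of_minimalFor {p : Fin 5 → Fin 5 → ℕ} (hp : IsArcCode p)
    (h4 : minimalFor swaps4 p = true) (h5 : minimalFor swaps5 p = true) : total p ≤ 4860000 := by
  have hd : ∀ i j, p i j ∈ digits := fun i j => by
    have := hp.lt_three i j
    generalize p i j = k at *
    interval_cases k <;> simp [digits]
  have h := certificate_eq_true
  simp only [certificate, List.all_eq_true, Bool.or_eq_true, Bool.not_eq_true',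
    decide_eq_true_eq] at h
  have h' := h _ (hd 0 1) _ (hd 0 2) _ (hd 0 3) _ (hd 1 2) _ (hd 1 3) _ (hd 2 3)
  have h4' : minimalFor swaps4 (pattern (p 0 1) (p 0 2) (p 0 3) (p 1 2) (p 1 3) (p 2 3) 0 0 0 0) =
      true := by
    -- The arcs at the fifth vertex do not enter, so the two patterns agree definitionally.
    rw [hp.eq_pattern] at h4
    exact h4
  have h'' := (h'.resolve_left (by simp [h4'])) _ (hd 0 4) _ (hd 1 4) _ (hd 2 4) _ (hd 3 4)
  rw [← hp.eq_pattern] at h''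
  exact h''.resolve_left (by simp [h5])

theorem flagIndex_lt {x y z : ℕ} (hx : x < 3) (hy : y < 3) (hz : z < 3) : flagIndex x y z < 27 := by
  unfold flagIndex
  omega

theorem entry_eq_gram (S : List (ℕ × List ℤ)) {i j : ℕ} (hi : i < 27) (hj : j < 27) :
    entry S i j = gram S i j := by
  simp [entry, gramTable, List.getD_eq_getElem?_getD, hi, hj]

theorem gram_comm (S : List (ℕ × List ℤ)) (i j : ℕ) : gram S i j = gram S j i := by
  unfold gram
  simp only [mul_comm]

theorem typeTerm_comm (x y z : ℕ) {i j : ℕ} (hi : i < 27) (hj : j < 27) :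
    typeTerm x y z i j = typeTerm x y z j i := by
  unfold typeTerm
  split <;>
    first
    | rfl
    | exact add_comm _ _
    | rw [entry_eq_gram _ hi hj, entry_eq_gram _ hj hi, gram_comm]

/-- Exchanging `b` and `c` turns the digits `(x, y, z)` of `(a, b)`, `(a, c)`, `(b, c)` into
`(y, x, opp z)`. -/
theorem vertexSquares_symm : ∀ s ∈ vertexSquares, ∀ x < 3, ∀ y < 3, ∀ z < 3,
    s.2.getD (flagIndex y x (opp z)) 0 = s.2.getD (flagIndex x y z) 0 := by
  decide +kernel

theorem gram_vertexSquares_swap {x y z : ℕ} (hx : x < 3) (hy : y < 3) (hz : z < 3) (j : ℕ) :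
    gram vertexSquares (flagIndex y x (opp z)) j = gram vertexSquares (flagIndex x y z) j := by
  unfold gram
  congr 1
  refine List.map_congr_left fun s hs => ?_
  rw [vertexSquares_symm s hs x hx y hy z hz]

theorem IsArcCode.flagIndex_lt {ι : Type*} {r : ι → ι → ℕ} (hr : IsArcCode r) (a b c d e f : ι) :
    flagIndex (r a b) (r c d) (r e f) < 27 :=
  OrientedGraph.flagIndex_lt (hr.lt_three _ _) (hr.lt_three _ _) (hr.lt_three _ _)

theorem tripleTerm_comm {ι : Type*} {r : ι → ι → ℕ} (hr : IsArcCode r) (a b c d e : ι) :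
    tripleTerm r a b c e d = tripleTerm r a b c d e :=
  typeTerm_comm _ _ _ (hr.flagIndex_lt ..) (hr.flagIndex_lt ..)

theorem rootedPair_eq_gram {ι : Type*} {r : ι → ι → ℕ} (hr : IsArcCode r) (a b c d e : ι) :
    rootedPair vertexSquares r a b c d e =
      gram vertexSquares (flagIndex (r a b) (r a c) (r b c))
        (flagIndex (r a d) (r a e) (r d e)) :=
  entry_eq_gram _ (hr.flagIndex_lt ..) (hr.flagIndex_lt ..)

theorem rootedPair_swap_pairs {ι : Type*} {r : ι → ι → ℕ} (hr : IsArcCode r) (a b c d e : ι) :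
    rootedPair vertexSquares r a d e b c = rootedPair vertexSquares r a b c d e := by
  rw [rootedPair_eq_gram hr, rootedPair_eq_gram hr, gram_comm]

theorem rootedPair_swap_left {ι : Type*} {r : ι → ι → ℕ} (hr : IsArcCode r) (a b c d e : ι) :
    rootedPair vertexSquares r a c b d e = rootedPair vertexSquares r a b c d e := by
  rw [rootedPair_eq_gram hr, rootedPair_eq_gram hr, hr.opp_eq b c,
    gram_vertexSquares_swap (hr.lt_three _ _) (hr.lt_three _ _) (hr.lt_three _ _)]

theorem rootedPair_swap_right {ι : Type*} {r : ι → ι → ℕ} (hr : IsArcCode r) (a b c d e : ι) :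
    rootedPair vertexSquares r a b c e d = rootedPair vertexSquares r a b c d e := by
  rw [← rootedPair_swap_pairs hr, rootedPair_swap_left hr, rootedPair_swap_pairs hr]

/-- The function of `5`-tuples whose sum over all tuples is estimated from below by squares and from
above by the certificate. -/
def orderedTerm {ι : Type*} (r : ι → ι → ℕ) (a b c d e : ι) : ℤ :=
  rootedPair vertexSquares r a b c d e + tripleTerm r a b c d e

/-- The eight orderings of five vertices belonging to the same pairing. -/
def orderings : Fin 5 × Fin 5 × Fin 5 × Fin 5 × Fin 5 →
    List (Fin 5 × Fin 5 × Fin 5 × Fin 5 × Fin 5)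
  | (a, b, c, d, e) => [(a, b, c, d, e), (a, b, c, e, d), (a, c, b, d, e), (a, c, b, e, d),
      (a, d, e, b, c), (a, d, e, c, b), (a, e, d, b, c), (a, e, d, c, b)]

theorem map_univ_perm :
    (Finset.univ : Finset (Equiv.Perm (Fin 5))).val.map
      (fun σ => (σ 0, σ 1, σ 2, σ 3, σ 4)) = ↑(pairings.flatMap orderings) := by
  decide +kernel

theorem sum_perm_orderedTerm {p : Fin 5 → Fin 5 → ℕ} (hp : IsArcCode p) :
    ∑ σ : Equiv.Perm (Fin 5), orderedTerm p (σ 0) (σ 1) (σ 2) (σ 3) (σ 4) = 2 * total p := by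
  have h : ∑ σ : Equiv.Perm (Fin 5), orderedTerm p (σ 0) (σ 1) (σ 2) (σ 3) (σ 4) =
      (((Finset.univ : Finset (Equiv.Perm (Fin 5))).val.map
        (fun σ => (σ 0, σ 1, σ 2, σ 3, σ 4))).map
          fun t => orderedTerm p t.1 t.2.1 t.2.2.1 t.2.2.2.1 t.2.2.2.2).sum := by
    rw [Multiset.map_map]; rfl
  rw [h, map_univ_perm, Multiset.map_coe, Multiset.sum_coe, total, ← List.sum_map_mul_left,
    List.map_flatMap, List.flatMap_def, List.sum_flatten, List.map_map]
  congr 1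
  refine List.map_congr_left fun t _ => ?_
  obtain ⟨a, b, c, d, e⟩ := t
  simp only [Function.comp, orderings, orderedTerm, pairingTerm, List.map_cons, List.map_nil,
    List.sum_cons, List.sum_nil]
  rw [tripleTerm_comm hp a b c d e, tripleTerm_comm hp a c b d e, tripleTerm_comm hp a d e b c,
    tripleTerm_comm hp a e d b c, rootedPair_swap_right hp a b c d e,
    rootedPair_swap_right hp a c b d e, rootedPair_swap_left hp a b c d e,
    rootedPair_swap_right hp a d e b c, rootedPair_swap_right hp a e d b c,
    rootedPair_swap_left hp a d e b c, rootedPair_swap_pairs hp a b c d e]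
  ring

/-- The sum over all orderings does not depend on how the five vertices are listed. -/
theorem total_comp_perm {p : Fin 5 → Fin 5 → ℕ} (hp : IsArcCode p) (σ : Equiv.Perm (Fin 5)) :
    total (fun i j => p (σ i) (σ j)) = total p := by
  have h := sum_perm_orderedTerm (hp.comp σ)
  have h' := sum_perm_orderedTerm hp
  rw [← Equiv.sum_comp (Equiv.mulLeft σ)] at h'
  have : (2 : ℤ) * total (fun i j => p (σ i) (σ j)) = 2 * total p := h.symm.trans h'
  omega

/-- Every pattern can be relisted so that it is minimal, and the certificate then applies. -/
theorem total_le {p : Fin 5 → Fin 5 → ℕ} (hp : IsArcCode p) : total p ≤ 4860000 := by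
  obtain ⟨σ, hσ⟩ := Finite.exists_min
    fun σ : Equiv.Perm (Fin 5) => orderWeight p (σ 0, σ 1, σ 2, σ 3)
  rw [← total_comp_perm hp σ]
  have key : ∀ a b, orderWeight (fun i j => p (σ i) (σ j)) (0, 1, 2, 3) ≤
      orderWeight (fun i j => p (σ i) (σ j)) (Equiv.swap a b 0, Equiv.swap a b 1, Equiv.swap a b 2,
        Equiv.swap a b 3) := fun a b => hσ (σ * Equiv.swap a b)
  refine total_le_of_minimalFor (hp.comp σ) ?_ ?_ <;>
    simp only [minimalFor, swaps4, swaps5, List.all_cons, List.all_nil, Bool.and_true,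
      Bool.and_eq_true, Nat.ble_eq]
  · exact ⟨key 0 1, key 0 2, key 0 3, key 1 2, key 1 3, key 2 3⟩
  · exact ⟨key 0 4, key 1 4, key 2 4, key 3 4⟩

/-! ### Summation over all tuples -/

theorem sum_fin_succ_fun {V : Type*} [Fintype V] {M : Type*} [AddCommMonoid M] {n : ℕ}
    (f : (Fin (n + 1) → V) → M) : ∑ x, f x = ∑ a, ∑ y : Fin n → V, f (Fin.cons a y) := by
  rw [← (Fin.consEquiv fun _ => V).sum_comp, Fintype.sum_prod_type]
  rfl

theorem sum_five_fun {V : Type*} [Fintype V] {M : Type*} [AddCommMonoid M]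
    (F : V → V → V → V → V → M) :
    ∑ x : Fin 5 → V, F (x 0) (x 1) (x 2) (x 3) (x 4) = ∑ a, ∑ b, ∑ c, ∑ d, ∑ e, F a b c d e := by
  simp only [sum_fin_succ_fun, Finset.univ_unique, Finset.sum_singleton]
  rfl

/-- The double sum of a Gram matrix over pairs of flags is a sum of squares. -/
theorem sum_sum_gram (S : List (ℕ × List ℤ)) {κ : Type*} [Fintype κ] (i : κ → ℕ) :
    ∑ d, ∑ e, gram S (i d) (i e) =
      (S.map fun s => (s.1 : ℤ) * (∑ d, s.2.getD (i d) 0) ^ 2).sum := by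
  unfold gram
  induction S with
  | nil => simp
  | cons s S ih =>
    simp only [List.map_cons, List.sum_cons, Finset.sum_add_distrib, ih]
    rw [sq, Finset.sum_mul_sum, Finset.mul_sum]
    simp only [Finset.mul_sum]

theorem sum_sum_gram_nonneg (S : List (ℕ × List ℤ)) {κ : Type*} [Fintype κ] (i : κ → ℕ) :
    0 ≤ ∑ d, ∑ e, gram S (i d) (i e) := by
  rw [sum_sum_gram]
  refine List.sum_nonneg fun z hz => ?_
  obtain ⟨s, -, rfl⟩ := List.mem_map.1 hz
  positivity

theorem sum_rootedPair_nonneg {V : Type*} [Fintype V] {r : V → V → ℕ} (hr : IsArcCode r) :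
    0 ≤ ∑ a, ∑ b, ∑ c, ∑ d, ∑ e, rootedPair vertexSquares r a b c d e := by
  refine Finset.sum_nonneg fun a _ => ?_
  have h := sum_sum_gram_nonneg vertexSquares
    fun q : V × V => flagIndex (r a q.1) (r a q.2) (r q.1 q.2)
  simpa only [Fintype.sum_prod_type, rootedPair_eq_gram hr] using h

open Classical in
/-- Summed over both flags, the types carrying squares contribute a nonnegative amount, and the
out-cherry counts the stars extending it. -/
theorem le_sum_typeTerm {κ : Type*} [Fintype κ] (x y z : ℕ) {i : κ → ℕ} (hi : ∀ d, i d < 27) :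
    (if x = 1 ∧ y = 1 ∧ z = 0 then
      4800000 * (Fintype.card κ * ((Finset.univ.filter fun d => i d = 18).card : ℤ)) else 0) ≤
    ∑ d, ∑ e, typeTerm x y z (i d) (i e) := by
  by_cases hxyz : x = 1 ∧ y = 1 ∧ z = 0
  · obtain ⟨rfl, rfl, rfl⟩ := hxyz
    have h : ∀ d, (bif i d == 18 then (2400000 : ℤ) else 0) =
        2400000 * if i d = 18 then 1 else 0 := fun d => by
      by_cases hd : i d = 18
      · simp [hd]
      · rw [beq_eq_false_iff_ne.2 hd, cond_false, if_neg hd, mul_zero]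
    simp only [typeTerm, h, Finset.sum_add_distrib, Finset.sum_const, Finset.card_univ,
      nsmul_eq_mul, ← Finset.mul_sum, and_self, if_true]
    rw [Finset.sum_boole]
    exact le_of_eq (by ring)
  · rw [if_neg hxyz]
    unfold typeTerm
    split
    case h_5 => simp at hxyz
    case h_6 => simp
    all_goals simp [entry_eq_gram _ (hi _) (hi _), sum_sum_gram_nonneg]

theorem flagIndex_eq_eighteen {x y z : ℕ} (hy : y < 3) (hz : z < 3) :
    flagIndex x y z = 18 ↔ x = 2 ∧ y = 0 ∧ z = 0 := by
  unfold flagIndex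
  omega

open Classical in
/-- The number of `4`-tuples `(a, b, c, d)` with `a → b`, `a → c`, `d → a` and no arcs among
`b, c, d`; the case `b = c` is allowed. -/
noncomputable def starCount {V : Type*} [Fintype V] (r : V → V → ℕ) : ℕ :=
  ∑ a, ∑ b, ∑ c, if r a b = 1 ∧ r a c = 1 ∧ r b c = 0 then
    (Finset.univ.filter fun d => r a d = 2 ∧ r b d = 0 ∧ r c d = 0).card else 0

theorem le_sum_tripleTerm {V : Type*} [Fintype V] {r : V → V → ℕ} (hr : IsArcCode r) :
    4800000 * (Fintype.card V * (starCount r : ℤ)) ≤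
      ∑ a, ∑ b, ∑ c, ∑ d, ∑ e, tripleTerm r a b c d e := by
  classical
  unfold starCount
  push_cast
  simp only [Finset.mul_sum]
  refine Finset.sum_le_sum fun a _ => Finset.sum_le_sum fun b _ => Finset.sum_le_sum fun c _ => ?_
  refine le_trans (le_of_eq ?_) (le_sum_typeTerm _ _ _ fun d => hr.flagIndex_lt a d b d c d)
  simp only [flagIndex_eq_eighteen (hr.lt_three _ _) (hr.lt_three _ _)]
  split <;> simp

/-- The number of stars with possibly coinciding out-leaves is at most `81 / 4800 · n⁴`. -/
theorem starCount_le {V : Type*} [Fintype V] {r : V → V → ℕ} (hr : IsArcCode r) :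
    4800 * starCount r ≤ 81 * Fintype.card V ^ 4 := by
  -- Each of the `120` orderings contributes the same sum over all tuples.
  have hsum : ∑ x : Fin 5 → V, ∑ σ : Equiv.Perm (Fin 5),
      orderedTerm (fun i j => r (x i) (x j)) (σ 0) (σ 1) (σ 2) (σ 3) (σ 4) =
      120 * ∑ a, ∑ b, ∑ c, ∑ d, ∑ e, orderedTerm r a b c d e := by
    rw [Finset.sum_comm, ← sum_five_fun]
    have h : ∀ σ : Equiv.Perm (Fin 5), ∑ x : Fin 5 → V,
        orderedTerm (fun i j => r (x i) (x j)) (σ 0) (σ 1) (σ 2) (σ 3) (σ 4) =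
        ∑ x : Fin 5 → V, orderedTerm r (x 0) (x 1) (x 2) (x 3) (x 4) := fun σ =>
      (σ.symm.arrowCongr (Equiv.refl V)).sum_comp
        fun x => orderedTerm r (x 0) (x 1) (x 2) (x 3) (x 4)
    simp only [h, Finset.sum_const, Finset.card_univ, Fintype.card_perm, Fintype.card_fin]
    rfl
  have hle : ∑ x : Fin 5 → V, ∑ σ : Equiv.Perm (Fin 5),
      orderedTerm (fun i j => r (x i) (x j)) (σ 0) (σ 1) (σ 2) (σ 3) (σ 4) ≤
      9720000 * (Fintype.card V : ℤ) ^ 5 := by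
    refine (Finset.sum_le_card_nsmul _ _ 9720000 fun x _ => ?_).trans (le_of_eq ?_)
    · rw [sum_perm_orderedTerm (hr.comp x)]
      linarith [total_le (hr.comp x)]
    · simp [mul_comm]
  have h1 := sum_rootedPair_nonneg hr
  have h2 := le_sum_tripleTerm hr
  rw [hsum] at hle
  simp only [orderedTerm, Finset.sum_add_distrib] at hle
  rcases Nat.eq_zero_or_pos (Fintype.card V) with h0 | h0
  · have : IsEmpty V := Fintype.card_eq_zero_iff.1 h0
    simp [starCount]
  -- Together: `120 · 4800000 · n · T ≤ 9720000 · n⁵`.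
  · have h3 : (Fintype.card V : ℤ) * (4800 * starCount r) ≤
        Fintype.card V * (81 * (Fintype.card V : ℤ) ^ 4) := by
      nlinarith
    exact_mod_cast le_of_mul_le_mul_left h3 (by exact_mod_cast h0)

/-! ### Induced maps, embeddings and copies -/

section Counting

variable {W V : Type*} [Fintype W] [Fintype V]

open Classical in
/-- The maps from `V(H)` to `V(G)` that preserve and reflect arcs. They need not be injective:
vertices of `H` with the same neighbours may be identified. -/
noncomputable def inducedMaps (H : OrientedGraph W) (G : OrientedGraph V) : Finset (W → V) :=
  Finset.univ.filter fun φ => ∀ i j, G.Adj (φ i) (φ j) ↔ H.Adj i j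

open Classical in
/-- The automorphisms of `H`, as permutations of its vertices. -/
noncomputable def automorphisms (H : OrientedGraph W) : Finset (Equiv.Perm W) :=
  Finset.univ.filter fun α => ∀ i j, H.Adj (α i) (α j) ↔ H.Adj i j

open Classical in
/-- The injective induced maps. -/
noncomputable def inducedEmbeddings (H : OrientedGraph W) (G : OrientedGraph V) :
    Finset (W → V) :=
  (inducedMaps H G).filter Function.Injective

theorem mem_inducedMaps {H : OrientedGraph W} {G : OrientedGraph V} {φ : W → V} :
    φ ∈ inducedMaps H G ↔ ∀ i j, G.Adj (φ i) (φ j) ↔ H.Adj i j := by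
  simp [inducedMaps]

theorem mem_automorphisms {H : OrientedGraph W} {α : Equiv.Perm W} :
    α ∈ automorphisms H ↔ ∀ i j, H.Adj (α i) (α j) ↔ H.Adj i j := by
  simp [automorphisms]

theorem mem_inducedEmbeddings {H : OrientedGraph W} {G : OrientedGraph V} {φ : W → V} :
    φ ∈ inducedEmbeddings H G ↔
      (∀ i j, G.Adj (φ i) (φ j) ↔ H.Adj i j) ∧ Function.Injective φ := by
  simp [inducedEmbeddings, mem_inducedMaps]

open Classical in
/-- Every induced copy of `H` is the image of exactly `|Aut H|` embeddings. -/
theorem card_inducedEmbeddings (H : OrientedGraph W) (G : OrientedGraph V) :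
    (inducedEmbeddings H G).card = inducedCopies H G * (automorphisms H).card := by
  rw [Finset.card_eq_sum_card_fiberwise (f := fun φ => Finset.univ.image φ)
    (t := ((Finset.univ : Finset V).powersetCard (Fintype.card W)).filter
      fun S => (G.induce S).Isomorphic H), inducedCopies, ← smul_eq_mul]
  · refine Finset.sum_const_nat fun S hS => ?_
    obtain ⟨hcard, ⟨e⟩⟩ := Finset.mem_filter.1 hS
    -- A fixed isomorphism `e` identifies the embeddings with image `S` with the automorphisms.
    symm
    refine Finset.card_bij (fun α _ w => (e.symm (α w) : V)) ?_ ?_ ?_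
    · intro α hα
      rw [mem_automorphisms] at hα
      have hinj : Function.Injective fun w => (e.symm (α w) : V) :=
        Subtype.val_injective.comp (e.symm.injective.comp α.injective)
      refine Finset.mem_filter.2 ⟨mem_inducedEmbeddings.2 ⟨fun i j => ?_, hinj⟩, ?_⟩
      · exact e.symm.map_rel_iff.trans (hα i j)
      · refine Finset.eq_of_subset_of_card_le (fun v hv => ?_) ?_
        · obtain ⟨w, -, rfl⟩ := Finset.mem_image.1 hv
          exact (e.symm (α w)).2
        · rw [Finset.card_image_of_injective _ hinj, Finset.card_univ,
            (Finset.mem_powersetCard.1 hcard).2]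
    · intro α _ β _ h
      ext w
      exact e.symm.injective (Subtype.ext (congrFun h w))
    · intro φ hφ
      obtain ⟨hφ, himg⟩ := Finset.mem_filter.1 hφ
      obtain ⟨hadj, hinj⟩ := mem_inducedEmbeddings.1 hφ
      have hmem : ∀ w, φ w ∈ S := fun w => by
        rw [← himg]; exact Finset.mem_image_of_mem _ (Finset.mem_univ _)
      have hinj' : Function.Injective fun w => e ⟨φ w, hmem w⟩ := fun w w' h =>
        hinj (congrArg Subtype.val (e.injective h))
      refine ⟨Equiv.ofBijective _ (Finite.injective_iff_bijective.1 hinj'),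
        mem_automorphisms.2 fun i j => ?_, ?_⟩
      · exact e.map_rel_iff.trans (hadj i j)
      · funext w
        exact congrArg Subtype.val (e.symm_apply_apply ⟨φ w, hmem w⟩)
  -- The image of an embedding induces a copy of `H`.
  · intro φ hφ
    obtain ⟨hadj, hinj⟩ := mem_inducedEmbeddings.1 (Finset.mem_coe.1 hφ)
    have hcard : (Finset.univ.image φ).card = Fintype.card W :=
      Finset.card_image_of_injective _ hinj
    refine Finset.mem_coe.2 (Finset.mem_filter.2
      ⟨Finset.mem_powersetCard.2 ⟨Finset.subset_univ _, hcard⟩, ⟨RelIso.symm ⟨Equiv.ofBijective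
        (fun w => ⟨φ w, Finset.mem_image_of_mem _ (Finset.mem_univ _)⟩)
        ⟨fun w w' h => hinj (congrArg Subtype.val h), fun v => ?_⟩, hadj _ _⟩⟩⟩)
    obtain ⟨w, -, hw⟩ := Finset.mem_image.1 v.2
    exact ⟨w, Subtype.ext hw⟩

theorem card_inducedEmbeddings_le (H : OrientedGraph W) (G : OrientedGraph V) :
    (inducedEmbeddings H G).card ≤ (inducedMaps H G).card :=
  Finset.card_le_card fun _ hφ => mem_inducedMaps.2 (mem_inducedEmbeddings.1 hφ).1

open Classical in
/-- Almost all induced maps are embeddings, since there are only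
`n ^ k - n.descFactorial k` noninjective maps. -/
theorem card_inducedMaps_le (H : OrientedGraph W) (G : OrientedGraph V) :
    (inducedMaps H G).card + (Fintype.card V).descFactorial (Fintype.card W) ≤
      (inducedEmbeddings H G).card + Fintype.card V ^ Fintype.card W := by
  have h1 : (inducedMaps H G).card = (inducedEmbeddings H G).card +
      ((inducedMaps H G).filter fun φ => ¬ Function.Injective φ).card :=
    (Finset.card_filter_add_card_filter_not _).symm
  have h2 : ((Finset.univ : Finset (W → V)).filter Function.Injective).card =
      (Fintype.card V).descFactorial (Fintype.card W) := by
    rw [← Fintype.card_embedding_eq, ← Fintype.card_subtype]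
    exact Fintype.card_congr (Equiv.subtypeInjectiveEquivEmbedding W V)
  have h3 := Finset.card_filter_add_card_filter_not (s := (Finset.univ : Finset (W → V)))
    Function.Injective
  have h4 : ((inducedMaps H G).filter fun φ => ¬ Function.Injective φ).card ≤
      ((Finset.univ : Finset (W → V)).filter fun φ => ¬ Function.Injective φ).card :=
    Finset.card_le_card (Finset.filter_subset_filter _ (Finset.subset_univ _))
  rw [Finset.card_univ, Fintype.card_fun] at h3
  omega

open Classical in
/-- An induced map into a blow-up is an induced map into the pattern together with, for
each vertex `i` of `H`, a choice of a vertex in the part assigned to `i`. -/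
theorem card_inducedMaps_blowup {I : Type*} [Fintype I] (H : OrientedGraph W)
    (P : OrientedGraph I) (f : V → I) :
    (inducedMaps H (P.blowup f)).card = ∑ g ∈ inducedMaps H P,
      ∏ i, (Finset.univ.filter fun v => f v = g i).card := by
  rw [Finset.card_eq_sum_card_fiberwise (f := fun φ => f ∘ φ) (t := inducedMaps H P)]
  · refine Finset.sum_congr rfl fun g hg => ?_
    rw [← Fintype.card_piFinset]
    congr 1
    ext φ
    simp only [Finset.mem_filter, mem_inducedMaps, Fintype.mem_piFinset, Finset.mem_univ, true_and,
      funext_iff, Function.comp]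
    rw [mem_inducedMaps] at hg
    refine ⟨fun h => h.2, fun h => ⟨fun i j => ?_, h⟩⟩
    rw [← hg i j, ← h i, ← h j]
    rfl
  · intro φ hφ
    have hφ' := mem_inducedMaps.1 (Finset.mem_coe.1 hφ)
    exact Finset.mem_coe.2 (mem_inducedMaps.2 hφ')

theorem isomorphic_reverse {W V : Type*} {H : OrientedGraph W} {G : OrientedGraph V} :
    G.reverse.Isomorphic H.reverse ↔ G.Isomorphic H :=
  ⟨fun ⟨e⟩ => ⟨⟨e.toEquiv, e.map_rel_iff⟩⟩, fun ⟨e⟩ => ⟨⟨e.toEquiv, e.map_rel_iff⟩⟩⟩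

theorem inducedCopies_reverse (H : OrientedGraph W) (G : OrientedGraph V) :
    inducedCopies H.reverse G.reverse = inducedCopies H G := by
  classical
  unfold inducedCopies
  congr 1
  exact Finset.filter_congr fun S _ => isomorphic_reverse (G := G.induce S)

theorem maxInducedCopies_reverse (H : OrientedGraph W) (n : ℕ) :
    maxInducedCopies H.reverse n = maxInducedCopies H n := by
  unfold maxInducedCopies
  congr 1
  ext k
  exact ⟨fun ⟨G, hG⟩ => ⟨G.reverse, (inducedCopies_reverse H G.reverse).symm.trans hG⟩,
    fun ⟨G, hG⟩ => ⟨G.reverse, (inducedCopies_reverse H G).trans hG⟩⟩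

end Counting

/-! ### Stars in oriented graphs -/

open Classical in
/-- The digit of an ordered pair of vertices: `1` for `u → v`, `2` for `v → u`, and `0` for
nonadjacent vertices. -/
noncomputable def arcCode {V : Type*} (G : OrientedGraph V) (u v : V) : ℕ :=
  if G.Adj u v then 1 else if G.Adj v u then 2 else 0

theorem arcCode_eq_one {V : Type*} {G : OrientedGraph V} {u v : V} (h : G.Adj u v) :
    G.arcCode u v = 1 := if_pos h

theorem arcCode_eq_two {V : Type*} {G : OrientedGraph V} {u v : V} (h : G.Adj v u) :
    G.arcCode u v = 2 := (if_neg (G.asymm v u h)).trans (if_pos h)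

theorem arcCode_eq_zero {V : Type*} {G : OrientedGraph V} {u v : V} (h : ¬ G.Adj u v)
    (h' : ¬ G.Adj v u) : G.arcCode u v = 0 := (if_neg h).trans (if_neg h')

theorem isArcCode_arcCode {V : Type*} (G : OrientedGraph V) : IsArcCode G.arcCode := by
  constructor <;> intro u v <;> by_cases h : G.Adj u v
  · simp [arcCode_eq_one h]
  · by_cases h' : G.Adj v u
    · simp [arcCode_eq_two h']
    · simp [arcCode_eq_zero h h']
  · rw [arcCode_eq_one h, arcCode_eq_two h]; rfl
  · by_cases h' : G.Adj v u
    · rw [arcCode_eq_one h', arcCode_eq_two h']; rfl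
    · rw [arcCode_eq_zero h h', arcCode_eq_zero h' h]; rfl

theorem card_inducedMaps_mixedStar_le {V : Type*} [Fintype V] (G : OrientedGraph V) :
    (inducedMaps mixedStar G).card ≤ starCount G.arcCode := by
  classical
  have h : starCount G.arcCode = (Finset.univ.filter fun x : Fin 4 → V =>
      (G.arcCode (x 0) (x 1) = 1 ∧ G.arcCode (x 0) (x 2) = 1 ∧ G.arcCode (x 1) (x 2) = 0) ∧
      G.arcCode (x 0) (x 3) = 2 ∧ G.arcCode (x 1) (x 3) = 0 ∧ G.arcCode (x 2) (x 3) = 0).card := by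
    rw [Finset.card_filter]
    simp only [sum_fin_succ_fun, Finset.univ_unique, Finset.sum_singleton]
    unfold starCount
    refine Finset.sum_congr rfl fun a _ => Finset.sum_congr rfl fun b _ =>
      Finset.sum_congr rfl fun c _ => ?_
    by_cases h : G.arcCode a b = 1 ∧ G.arcCode a c = 1 ∧ G.arcCode b c = 0
    · rw [if_pos h, Finset.card_filter]
      exact Finset.sum_congr rfl fun d _ => if_congr ⟨fun h' => ⟨h, h'⟩, And.right⟩ rfl rfl
    · rw [if_neg h]
      exact (Finset.sum_eq_zero fun d _ => if_neg fun h' => h h'.1).symm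
  rw [h]
  refine Finset.card_le_card fun x hx => ?_
  have hx := mem_inducedMaps.1 hx
  have h1 : ∀ i j, mixedStar.Adj i j → G.arcCode (x i) (x j) = 1 := fun i j h =>
    arcCode_eq_one ((hx i j).2 h)
  have h2 : ∀ i j, mixedStar.Adj j i → G.arcCode (x i) (x j) = 2 := fun i j h =>
    arcCode_eq_two ((hx j i).2 h)
  have h0 : ∀ i j, ¬ mixedStar.Adj i j → ¬ mixedStar.Adj j i → G.arcCode (x i) (x j) = 0 :=
    fun i j h h' => arcCode_eq_zero (mt (hx i j).1 h) (mt (hx j i).1 h')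
  simp only [mixedStar] at h0 h1 h2
  exact Finset.mem_filter.2 ⟨Finset.mem_univ _,
    ⟨h1 0 1 (by decide), h1 0 2 (by decide), h0 1 2 (by decide) (by decide)⟩,
    h2 0 3 (by decide), h0 1 3 (by decide) (by decide), h0 2 3 (by decide) (by decide)⟩

theorem card_automorphisms_mixedStar : (automorphisms mixedStar).card = 2 := by
  have h : (Finset.univ.filter fun α : Equiv.Perm (Fin 4) =>
      ∀ i j, (α i, α j) ∈ ({(0, 1), (0, 2), (3, 0)} : Finset (Fin 4 × Fin 4)) ↔
        (i, j) ∈ ({(0, 1), (0, 2), (3, 0)} : Finset (Fin 4 × Fin 4))).card = 2 := by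
    decide +kernel
  rw [← h]
  unfold automorphisms
  congr 1
  ext α
  simp [mixedStar]

theorem card_inducedEmbeddings_mixedStar {V : Type*} [Fintype V] (G : OrientedGraph V) :
    (inducedEmbeddings mixedStar G).card = 2 * inducedCopies mixedStar G := by
  rw [card_inducedEmbeddings, card_automorphisms_mixedStar, mul_comm]

/-- The upper bound on the number of induced stars; `81 / 9600 = (81 / 400) / 4!`. -/
theorem inducedCopies_mixedStar_le {V : Type*} [Fintype V] (G : OrientedGraph V) :
    9600 * inducedCopies mixedStar G ≤ 81 * Fintype.card V ^ 4 := by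
  have h1 := card_inducedEmbeddings_mixedStar G
  have h2 := card_inducedEmbeddings_le mixedStar G
  have h3 := card_inducedMaps_mixedStar_le G
  have h4 := starCount_le (isArcCode_arcCode G)
  omega

/-! ### Densities in blow-ups -/

theorem tendsto_descFactorial_div_pow (k : ℕ) :
    Tendsto (fun n : ℕ => (n.descFactorial k : ℝ) / (n : ℝ) ^ k) atTop (𝓝 1) := by
  have h : Tendsto (fun n : ℕ => ∏ i ∈ Finset.range k, (1 - (i : ℝ) / (n : ℝ))) atTop
      (𝓝 (∏ _i ∈ Finset.range k, (1 - 0))) := tendsto_finsetProd _ fun i _ =>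
    tendsto_const_nhds.sub (tendsto_const_div_atTop_nhds_zero_nat (i : ℝ))
  simp only [sub_zero, Finset.prod_const_one] at h
  refine h.congr' ?_
  filter_upwards [eventually_ge_atTop (k + 1)] with n hn
  have hn0 : (n : ℝ) ≠ 0 := by
    have : n ≠ 0 := by omega
    exact_mod_cast this
  rw [Nat.descFactorial_eq_prod_range, Nat.cast_prod, ← Finset.card_range k, ← Finset.prod_const,
    Finset.card_range, ← Finset.prod_div_distrib]
  refine Finset.prod_congr rfl fun i hi => ?_
  rw [Nat.cast_sub (by have := Finset.mem_range.1 hi; omega), sub_div, div_self hn0]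

theorem tendsto_pow_div_choose (k : ℕ) :
    Tendsto (fun n : ℕ => (n : ℝ) ^ k / (n.choose k : ℝ)) atTop (𝓝 k.factorial) := by
  have h := ((tendsto_descFactorial_div_pow k).inv₀ one_ne_zero).const_mul (k.factorial : ℝ)
  rw [inv_one, mul_one] at h
  refine h.congr fun n => ?_
  have hk : (k.factorial : ℝ) ≠ 0 := by exact_mod_cast k.factorial_ne_zero
  rw [Nat.descFactorial_eq_factorial_mul_choose, Nat.cast_mul, inv_div, mul_div_assoc',
    mul_div_mul_left _ _ hk]

open Classical in
theorem tendsto_card_inducedMaps_blowup {W I : Type*} [Fintype W] [Fintype I]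
    (H : OrientedGraph W) (P : OrientedGraph I) {f : (n : ℕ) → Fin n → I} {α : I → ℝ}
    (hf : HasLimitPartSizes f α) :
    Tendsto (fun n : ℕ => ((inducedMaps H (P.blowup (f n))).card : ℝ) / (n : ℝ) ^ Fintype.card W)
      atTop (𝓝 (∑ g ∈ inducedMaps H P, ∏ i, α (g i))) := by
  have h := tendsto_finsetSum (inducedMaps H P) fun g _ =>
    tendsto_finsetProd (Finset.univ : Finset W) fun i _ => hf (g i)
  refine h.congr fun n => ?_
  rw [card_inducedMaps_blowup, Nat.cast_sum, Finset.sum_div]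
  refine Finset.sum_congr rfl fun g _ => ?_
  rw [Finset.prod_div_distrib, Finset.prod_const, Finset.card_univ, Nat.cast_prod]

theorem tendsto_card_inducedEmbeddings_blowup {W I : Type*} [Fintype W] [Fintype I] [DecidableEq I]
    (H : OrientedGraph W) (P : OrientedGraph I) {f : (n : ℕ) → Fin n → I} {α : I → ℝ}
    (hf : HasLimitPartSizes f α) :
    Tendsto (fun n : ℕ =>
      ((inducedEmbeddings H (P.blowup (f n))).card : ℝ) / (n : ℝ) ^ Fintype.card W)
      atTop (𝓝 (∑ g ∈ inducedMaps H P, ∏ i, α (g i))) := by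
  have h1 := tendsto_card_inducedMaps_blowup H P (f := f) (α := α) (by convert hf)
  have h2 := (h1.add (tendsto_descFactorial_div_pow (Fintype.card W))).sub
    (tendsto_const_nhds (x := (1 : ℝ)))
  rw [add_sub_cancel_right] at h2
  refine tendsto_of_tendsto_of_tendsto_of_le_of_le' h2 h1 ?_ ?_
  · filter_upwards [eventually_gt_atTop 0] with n hn
    have hn : (0 : ℝ) < (n : ℝ) ^ Fintype.card W := by positivity
    have h := card_inducedMaps_le H (P.blowup (f n))
    rw [Fintype.card_fin] at h
    rw [← add_div, sub_le_iff_le_add, div_add_one hn.ne']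
    exact div_le_div_of_nonneg_right (by exact_mod_cast h) hn.le
  · exact Eventually.of_forall fun n =>
      div_le_div_of_nonneg_right (Nat.cast_le.2 (card_inducedEmbeddings_le _ _)) (by positivity)

/-- The value of the density polynomial of the construction at its part sizes. -/
theorem sum_inducedMaps_mixedStar_fivePattern :
    ∑ g ∈ inducedMaps mixedStar fivePattern, ∏ i, fivePartSizes (g i) = 81 / 4800 := by
  -- The polynomial in the integer weights `20 · fivePartSizes`; here `2700 / 20 ^ 4 = 81 / 4800`.
  have h : ∑ g : Fin 4 → Fin 5, (if ∀ i j, (g i, g j) ∈ ({(0, 1), (1, 2), (2, 3), (3, 0), (2, 4),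
      (0, 4)} : Finset (Fin 5 × Fin 5)) ↔ (i, j) ∈ ({(0, 1), (0, 2), (3, 0)} :
      Finset (Fin 4 × Fin 4)) then ∏ i, (![3, 5, 3, 5, 4] (g i) : ℕ) else 0) = 2700 := by
    decide +kernel
  have hα : ∀ i, fivePartSizes i = ((![3, 5, 3, 5, 4] i : ℕ) : ℝ) / 20 := by
    intro i
    fin_cases i <;> norm_num [fivePartSizes]
  have hmap : inducedMaps mixedStar fivePattern = Finset.univ.filter fun g : Fin 4 → Fin 5 =>
      ∀ i j, (g i, g j) ∈ ({(0, 1), (1, 2), (2, 3), (3, 0), (2, 4),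
      (0, 4)} : Finset (Fin 5 × Fin 5)) ↔ (i, j) ∈ ({(0, 1), (0, 2), (3, 0)} :
      Finset (Fin 4 × Fin 4)) := by
    ext g
    rw [mem_inducedMaps, Finset.mem_filter]
    exact (and_iff_right (Finset.mem_univ _)).symm
  rw [← Finset.sum_filter, ← hmap] at h
  simp only [hα, Finset.prod_div_distrib, Finset.prod_const, Finset.card_univ, Fintype.card_fin]
  rw [← Finset.sum_div]
  have h' := congrArg (Nat.cast : ℕ → ℝ) h
  push_cast at h'
  rw [h']
  norm_num

theorem tendsto_inducedDensity_mixedStar {f : (n : ℕ) → Fin n → Fin 5}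
    (hf : HasLimitPartSizes f fivePartSizes) :
    Tendsto (fun n : ℕ => inducedDensity mixedStar (fivePattern.blowup (f n))) atTop
      (𝓝 (81 / 400)) := by
  have h := ((tendsto_card_inducedEmbeddings_blowup mixedStar fivePattern hf).mul
    (tendsto_pow_div_choose (Fintype.card (Fin 4)))).div_const 2
  rw [sum_inducedMaps_mixedStar_fivePattern] at h
  have hval : (81 / 4800 * ((Fintype.card (Fin 4)).factorial : ℝ)) / 2 = 81 / 400 := by
    norm_num [Fintype.card_fin, Nat.factorial]
  rw [hval] at h
  refine h.congr' ?_
  filter_upwards [eventually_gt_atTop 0] with n hn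
  have hn : (n : ℝ) ^ Fintype.card (Fin 4) ≠ 0 := by positivity
  rw [div_mul_div_cancel₀ hn, card_inducedEmbeddings_mixedStar, inducedDensity, Fintype.card_fin,
    Fintype.card_fin, Nat.cast_mul, Nat.cast_two]
  ring

/-! ### Partitions with prescribed limiting part sizes -/

theorem card_filter_val_Ico {n s t : ℕ} (ht : t ≤ n) :
    (Finset.univ.filter fun v : Fin n => s ≤ v.1 ∧ v.1 < t).card = t - s := by
  rw [← Nat.card_Ico, ← Finset.card_map Fin.valEmbedding]
  congr 1
  ext v
  simp only [Finset.mem_map, Finset.mem_filter, Finset.mem_univ, true_and, Fin.valEmbedding_apply,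
    Finset.mem_Ico]
  exact ⟨fun ⟨w, hw, h⟩ => h ▸ hw, fun h => ⟨⟨v, h.2.trans_le ht⟩, h, rfl⟩⟩

theorem tendsto_card_interval_div {a b : ℝ} (ha : 0 ≤ a) (hab : a ≤ b) (hb : b ≤ 1) :
    Tendsto (fun n : ℕ => ((Finset.univ.filter fun v : Fin n =>
      ⌈a * n⌉₊ ≤ v.1 ∧ v.1 < ⌈b * n⌉₊).card : ℝ) / (n : ℝ)) atTop (𝓝 (b - a)) := by
  have h := ((tendsto_nat_ceil_mul_div_atTop (ha.trans hab)).comp tendsto_natCast_atTop_atTop).sub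
    ((tendsto_nat_ceil_mul_div_atTop ha).comp tendsto_natCast_atTop_atTop)
  refine h.congr fun n => ?_
  have hbn : ⌈b * n⌉₊ ≤ n := Nat.ceil_le.2 (mul_le_of_le_one_left n.cast_nonneg hb)
  have hle : ⌈a * n⌉₊ ≤ ⌈b * n⌉₊ := Nat.ceil_mono (by gcongr)
  rw [card_filter_val_Ico hbn, Nat.cast_sub hle, sub_div]
  rfl

/-- The index of the interval containing `v` when the natural numbers are cut at `a, b, c, d`. -/
def intervalIndex (a b c d v : ℕ) : Fin 5 :=
  if v < a then 0 else if v < b then 1 else if v < c then 2 else if v < d then 3 else 4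

theorem intervalIndex_eq_iff {a b c d n v : ℕ} (hab : a ≤ b) (hbc : b ≤ c) (hcd : c ≤ d)
    (hv : v < n) (i : Fin 5) :
    intervalIndex a b c d v = i ↔ ![0, a, b, c, d] i ≤ v ∧ v < ![a, b, c, d, n] i := by
  unfold intervalIndex
  revert i
  simp only [Fin.forall_fin_succ]
  split_ifs <;> simp <;> omega

theorem exists_hasLimitPartSizes :
    ∃ f : (n : ℕ) → Fin n → Fin 5, HasLimitPartSizes f fivePartSizes := by
  refine ⟨fun n v => intervalIndex ⌈(3 / 20 : ℝ) * n⌉₊ ⌈(2 / 5 : ℝ) * n⌉₊ ⌈(11 / 20 : ℝ) * n⌉₊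
    ⌈(4 / 5 : ℝ) * n⌉₊ v, fun i => ?_⟩
  have hmono : ∀ (n : ℕ) {a b : ℝ}, a ≤ b → ⌈a * n⌉₊ ≤ ⌈b * n⌉₊ := fun n a b hab =>
    Nat.ceil_mono (by gcongr)
  have hi : ∀ (n : ℕ) (v : Fin n), intervalIndex ⌈(3 / 20 : ℝ) * n⌉₊ ⌈(2 / 5 : ℝ) * n⌉₊
      ⌈(11 / 20 : ℝ) * n⌉₊ ⌈(4 / 5 : ℝ) * n⌉₊ v = i ↔
      ⌈(![0, 3 / 20, 2 / 5, 11 / 20, 4 / 5] i : ℝ) * n⌉₊ ≤ v.1 ∧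
        v.1 < ⌈(![3 / 20, 2 / 5, 11 / 20, 4 / 5, 1] i : ℝ) * n⌉₊ := fun n v => by
    rw [intervalIndex_eq_iff (hmono n (by norm_num)) (hmono n (by norm_num))
      (hmono n (by norm_num)) v.2]
    fin_cases i <;> simp
  simp only [hi]
  have hsize : fivePartSizes i = (![3 / 20, 2 / 5, 11 / 20, 4 / 5, 1] i : ℝ) -
      ![0, 3 / 20, 2 / 5, 11 / 20, 4 / 5] i := by
    fin_cases i <;> norm_num [fivePartSizes]
  rw [hsize]
  refine tendsto_card_interval_div ?_ ?_ ?_ <;> fin_cases i <;> norm_num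

/-! ### The inducibility of the star -/

/-- The maximum lies between the count in the five-part construction and the bound of
`inducedCopies_mixedStar_le`, whose densities have the same limit. -/
theorem hasInducibility_mixedStar : HasInducibility mixedStar (81 / 400) := by
  obtain ⟨f, hf⟩ := exists_hasLimitPartSizes
  have hup : Tendsto (fun n : ℕ => (81 / 9600 : ℝ) * ((n : ℝ) ^ 4 / (n.choose 4 : ℝ))) atTop
      (𝓝 (81 / 400)) := by
    have h := (tendsto_pow_div_choose 4).const_mul (81 / 9600 : ℝ)
    have hval : (81 / 9600 : ℝ) * (Nat.factorial 4 : ℝ) = 81 / 400 := by norm_num [Nat.factorial]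
    rwa [hval] at h
  refine tendsto_of_tendsto_of_tendsto_of_le_of_le (tendsto_inducedDensity_mixedStar hf) hup
    (fun n => ?_) fun n => ?_
  · simp only [inducedDensity, Fintype.card_fin]
    refine div_le_div_of_nonneg_right ?_ (Nat.cast_nonneg _)
    exact_mod_cast (isGreatest_maxInducedCopies mixedStar n).2 ⟨_, rfl⟩
  · simp only [Fintype.card_fin]
    rw [← mul_div_assoc]
    refine div_le_div_of_nonneg_right ?_ (Nat.cast_nonneg _)
    obtain ⟨G, hG⟩ := (isGreatest_maxInducedCopies mixedStar n).1
    have h := inducedCopies_mixedStar_le G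
    rw [Fintype.card_fin] at h
    have h' : (9600 : ℝ) * inducedCopies mixedStar G ≤ 81 * (n : ℝ) ^ 4 := by exact_mod_cast h
    rw [← hG]
    linarith

theorem inducedDensity_reverse {W V : Type*} [Fintype W] [Fintype V] (H : OrientedGraph W)
    (G : OrientedGraph V) : inducedDensity H.reverse G.reverse = inducedDensity H G := by
  simp only [inducedDensity, inducedCopies_reverse]

theorem HasInducibility.reverse {W : Type*} [Fintype W] {H : OrientedGraph W} {c : ℝ}
    (h : HasInducibility H c) : HasInducibility H.reverse c := by
  simpa only [HasInducibility, maxInducedCopies_reverse] using h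

end OrientedGraph

theorem mainTheorem5 :
    OrientedGraph.HasInducibility OrientedGraph.mixedStar (81 / 400) ∧
    OrientedGraph.HasInducibility OrientedGraph.mixedStar.reverse (81 / 400) ∧
    (∃ f : (n : ℕ) → Fin n → Fin 5,
      OrientedGraph.HasLimitPartSizes f OrientedGraph.fivePartSizes) ∧
    ∀ f : (n : ℕ) → Fin n → Fin 5,
      OrientedGraph.HasLimitPartSizes f OrientedGraph.fivePartSizes →
      Tendsto (fun n : ℕ => OrientedGraph.inducedDensity OrientedGraph.mixedStar
        (OrientedGraph.fivePattern.blowup (f n))) atTop (𝓝 (81 / 400)) ∧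
      Tendsto (fun n : ℕ => OrientedGraph.inducedDensity OrientedGraph.mixedStar.reverse
        (OrientedGraph.fivePattern.reverse.blowup (f n))) atTop (𝓝 (81 / 400)) :=
  ⟨OrientedGraph.hasInducibility_mixedStar, OrientedGraph.hasInducibility_mixedStar.reverse,
    OrientedGraph.exists_hasLimitPartSizes, fun f hf =>
      ⟨OrientedGraph.tendsto_inducedDensity_mixedStar hf,
        (OrientedGraph.tendsto_inducedDensity_mixedStar hf).congr fun n =>
          (OrientedGraph.inducedDensity_reverse OrientedGraph.mixedStar
            (OrientedGraph.fivePattern.blowup (f n))).symm⟩⟩
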